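/- Let $A$ be a non-zero real or complex square matrix, $b$ a vector of matching size and $p\ge 0$ an integer. Write $\|b\|_\infty$ for the maximum norm and $\|A\|_\infty$ for the induced matrix norm (maximal absolute row sum). Let $$I_{p+1}=\varphi_{p+1}(A)b,\qquad \varphi_{p+1}(A)=\int_0^1 \frac{\theta^{p}}{p!}\,e^{(1-\theta)A}\,d\theta ,$$ and, for an $(n+1)$-point quadrature rule on $[0,1]$ with nodes $x_i$ and weights $w_i$, let $$\hat I_{p+1}=\sum_{i=1}^{n+1} w_i\,\frac{x_i^{p}}{p!}\,e^{(1-x_i)A}b .$$ The $(n+1)$-point Clenshaw–Curtis rule is the interpolatory rule with nodes $\frac12\bigl(1+\cos\frac{j\pi}{n}\bigr)$, $0\le j\le n$; the $(n+1)$-point Gauss rule is the interpolatory rule whose nodes are the zeros of the Legendre polynomial of degree $n+1$ shifted to $[0,1]$. Below, $0^0=1$. 1. If $n\ge\max\bigl(4,\lceil\frac{1+\sqrt2}{2}\|A\|_\infty+p\rceil\bigr)$ and $n$ is even, then $(n+1)$-point Clenshaw–Curtis quadrature satisfies $$\|I_{p+1}-\hat I_{p+1}\|_\infty\le\frac{\|b\|_\infty}{2^{p+1}p!}\left(\frac{n-p}{\frac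 e2\|A\|_\infty}\right)^{-(n-p)} .$$ 2. If $n\ge\max\bigl(4,\lceil\frac{1+\sqrt2}{2}\|A\|_\infty+p\rceil\bigr)$ and $n$ is odd, then $(n+1)$-point Clenshaw–Curtis quadrature satisfies $$\|I_{p+1}-\hat I_{p+1}\|_\infty\le\frac{\|b\|_\infty}{2^{p+1}p!}\left(\frac{n-1-p}{\frac e2\|A\|_\infty}\right)^{-(n-1-p)} .$$ 3. If $n\ge\max\bigl(2,\lceil\frac{1+\sqrt2}{4}\|A\|_\infty+\frac p2\rceil\bigr)$, then $(n+1)$-point Gauss quadrature satisfies $$\|I_{p+1}-\hat I_{p+1}\|_\infty\le\frac{\|b\|_\infty}{2^{p+1}p!}\left(\frac{2n-p}{\frac e2\|A\|_\infty}\right)^{-(2n-p)} .$$ 4. Consequently both rules converge supergeometrically: for fixed $A$, $b$, $p$ and every $r>0$, the error $\|I_{p+1}-\hat I_{p+1}\|_\infty$ of the $(n+1)$-point rule is $o(r^n)$ as $n\to\infty$. -/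

import Mathlib

open Polynomial Asymptotics
open scoped Nat

noncomputable section

namespace PhiQuadrature

/-- The matrix norm induced by the maximum norm on vectors, i.e. the maximal absolute row sum
(Mathlib's `Matrix.linftyOpNormedAddCommGroup` norm). -/
def matrixNormInf {𝕜 ι : Type*} [RCLike 𝕜] [Fintype ι] (A : Matrix ι ι 𝕜) : ℝ :=
  letI : NormedAddCommGroup (Matrix ι ι 𝕜) := Matrix.linftyOpNormedAddCommGroup
  ‖A‖

/-- The `φ`-functions of a square matrix: `φ₀(A) = exp A` and
`φ_{q+1}(A) = ∫₀¹ (θ ^ q / q!) exp((1 - θ) A) dθ`, the integral being taken entry by entry. -/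
def phi {𝕜 ι : Type*} [RCLike 𝕜] [Fintype ι] [DecidableEq ι] (p : ℕ) (A : Matrix ι ι 𝕜) :
    Matrix ι ι 𝕜 :=
  match p with
  | 0 => NormedSpace.exp A
  | q + 1 => Matrix.of fun i j =>
      ∫ θ in (0 : ℝ)..1, (θ ^ q / (q ! : ℝ)) • (NormedSpace.exp ((1 - θ) • A) i j)

/-- The weight at the node `x ∈ S` of the interpolatory quadrature rule on `[0, 1]` with
(distinct) nodes `S`: the integral over `[0, 1]` of the Lagrange basis polynomial of `x`. -/
def weight (S : Finset ℝ) (x : ℝ) : ℝ :=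
  ∫ t in (0 : ℝ)..1, (Lagrange.basis S id x).eval t

/-- The nodes of the `(n + 1)`-point Clenshaw–Curtis rule on `[0, 1]` (for `n ≥ 1`): the images of
the Chebyshev points `cos (j π / n)`, `0 ≤ j ≤ n`, under the affine map `s ↦ (1 + s) / 2` from
`[-1, 1]` onto `[0, 1]`. -/
def clenshawCurtisNodes (n : ℕ) : Finset ℝ :=
  (Finset.range (n + 1)).image fun j : ℕ => (1 + Real.cos (j * Real.pi / n)) / 2

/-- The nodes of the `(n + 1)`-point Gauss–Legendre rule on `[0, 1]`: the real zeros of the shifted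
Legendre polynomial of degree `n + 1` (all its zeros are real, simple and in `(0, 1)`). -/
def gaussNodes (n : ℕ) : Finset ℝ :=
  ((shiftedLegendre (n + 1)).map (Int.castRingHom ℝ)).roots.toFinset

/-- The approximation of `φ_j(A) b`, `j ≥ 1`, by the interpolatory quadrature rule on `[0, 1]` with
nodes `S`: the sum over the nodes `x` of `w_x x ^ (j - 1) / (j - 1)! exp((1 - x) A) b`. -/
def phiQuad {𝕜 ι : Type*} [RCLike 𝕜] [Fintype ι] [DecidableEq ι] (S : Finset ℝ) (j : ℕ)
    (A : Matrix ι ι 𝕜) (b : ι → 𝕜) : ι → 𝕜 :=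
  ∑ x ∈ S, (weight S x * (x ^ (j - 1) / ((j - 1)! : ℝ))) •
    (NormedSpace.exp ((1 - x) • A)).mulVec b

/-- The error, in the maximum norm, of the quadrature approximation of `φ_j(A) b`. -/
def quadError {𝕜 ι : Type*} [RCLike 𝕜] [Fintype ι] [DecidableEq ι] (S : Finset ℝ) (j : ℕ)
    (A : Matrix ι ι 𝕜) (b : ι → 𝕜) : ℝ :=
  ‖(phi j A).mulVec b - phiQuad S j A b‖

/-- Supergeometric decay: faster than every geometric sequence. -/
def Supergeometric (e : ℕ → ℝ) : Prop :=
  ∀ r : ℝ, 0 < r → e =o[Filter.atTop] fun n : ℕ => r ^ n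

end PhiQuadrature

end

noncomputable section

namespace PhiQuadrature

/-! ### Integration of polynomials over the unit interval -/

/-! Let `L` be the error functional `defect`, integral minus rule. Expanding the exponential in
powers of `1 - θ` turns the error into the sum over `l` of `L (x ^ p (1 - x) ^ l) / (p! l!)` times
`A ^ l b` (`hasSum_phi_succ_mulVec`, `hasSum_phiQuad`), so only scalar estimates of `L` on these
polynomials are needed.

Let `T_k` be the Chebyshev polynomials on `[0, 1]`, and suppose `|L T_k| ≤ K ρ ^ k / 2` for all `k`.
In the Chebyshev basis, multiplication by `x` or `1 - x` is tridiagonal with entries of modulus 1/4,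
1/2, 1/4, so each factor costs at most `(2 + ρ + ρ⁻¹) / 4`, which is at most `ρ / 2` once `1 + √2 ≤
ρ` (`abs_defect_monomial_le`). Summing the series bounds the error by `‖b‖ / p! * K (ρ / 2) ^ p exp
(ρ ‖A‖ / 2)` (`quadError_le_of_defect`).

The constant `K` comes from exactness: `L T_k` vanishes up to degree `n` (Clenshaw–Curtis) or `2 n +
1` (Gauss), and beyond that is at most 16/15, because Clenshaw–Curtis aliases `T_k` to a low degree
and Gauss weights are nonnegative. Clenshaw–Curtis also integrates every odd `T_k` exactly, so for
even `n` its first error is at `n + 2`. This permits `K = ρ ^ (-n) / 2`, respectively `ρ ^ (-2 n) /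
2`, and optimizing `ρ` gives the explicit bounds. Odd `n` loses one degree. For fixed `A`, an
arbitrarily large fixed `ρ` gives supergeometric convergence. -/

lemma intervalIntegrable_eval (q : ℝ[X]) (a b : ℝ) :
    IntervalIntegrable (fun t => q.eval t) MeasureTheory.volume a b :=
  q.continuous.intervalIntegrable a b

/-- The integral over `[0, 1]`, as a linear functional on real polynomials. -/
def unitIntegral : ℝ[X] →ₗ[ℝ] ℝ where
  toFun q := ∫ t in (0 : ℝ)..1, q.eval t
  map_add' p q := by
    simp only [eval_add]
    exact intervalIntegral.integral_add (intervalIntegrable_eval _ _ _)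
      (intervalIntegrable_eval _ _ _)
  map_smul' c q := by
    simp [eval_smul, intervalIntegral.integral_const_mul]

lemma unitIntegral_apply (q : ℝ[X]) : unitIntegral q = ∫ t in (0 : ℝ)..1, q.eval t := rfl

lemma unitIntegral_derivative (q : ℝ[X]) :
    unitIntegral (derivative q) = q.eval 1 - q.eval 0 := by
  rw [unitIntegral_apply]
  exact intervalIntegral.integral_eq_sub_of_hasDerivAt (fun x _ => q.hasDerivAt x)
    (intervalIntegrable_eval _ _ _)

lemma unitIntegral_nonneg {q : ℝ[X]} (hq : ∀ x ∈ Set.Icc (0 : ℝ) 1, 0 ≤ q.eval x) :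
    0 ≤ unitIntegral q :=
  intervalIntegral.integral_nonneg zero_le_one hq

lemma abs_unitIntegral_le_one {q : ℝ[X]} (hq : ∀ x ∈ Set.Icc (0 : ℝ) 1, |q.eval x| ≤ 1) :
    |unitIntegral q| ≤ 1 := by
  have h := intervalIntegral.norm_integral_le_of_norm_le_const (a := (0 : ℝ)) (b := 1)
    (f := fun t => q.eval t) (C := 1) fun x hx => by
      rw [Set.uIoc_of_le zero_le_one] at hx
      exact hq x ⟨hx.1.le, hx.2⟩
  simpa [unitIntegral_apply] using h

lemma eq_zero_of_unitIntegral_eq_zero {q : ℝ[X]} (hq : ∀ x ∈ Set.Icc (0 : ℝ) 1, 0 ≤ q.eval x)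
    (h : unitIntegral q = 0) : q = 0 := by
  by_contra hne
  have hinf : (Set.Icc (0 : ℝ) 1).Infinite := Set.Icc_infinite zero_lt_one
  obtain ⟨c, hc, hc0⟩ : ∃ c ∈ Set.Icc (0 : ℝ) 1, q.eval c ≠ 0 := by
    by_contra! hall
    exact hne (q.eq_zero_of_infinite_isRoot (hinf.mono fun x hx => hall x hx))
  have := intervalIntegral.integral_pos (zero_lt_one' ℝ) q.continuous.continuousOn
    (fun x hx => hq x ⟨hx.1.le, hx.2⟩) ⟨c, hc, lt_of_le_of_ne (hq c hc) hc0.symm⟩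
  rw [unitIntegral_apply] at h
  exact this.ne' h

/-! ### Interpolatory quadrature -/

/-- The interpolatory quadrature rule with nodes `S`, as a linear functional on polynomials. -/
def quad (S : Finset ℝ) : ℝ[X] →ₗ[ℝ] ℝ where
  toFun q := ∑ x ∈ S, weight S x * q.eval x
  map_add' p q := by simp [mul_add, Finset.sum_add_distrib]
  map_smul' c q := by
    simp only [eval_smul, smul_eq_mul, RingHom.id_apply, Finset.mul_sum]
    exact Finset.sum_congr rfl fun _ _ => by ring

lemma quad_apply (S : Finset ℝ) (q : ℝ[X]) : quad S q = ∑ x ∈ S, weight S x * q.eval x := rfl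

lemma quad_eq_of_eval_eq {S : Finset ℝ} {q r : ℝ[X]} (h : ∀ x ∈ S, q.eval x = r.eval x) :
    quad S q = quad S r :=
  Finset.sum_congr rfl fun x hx => by rw [h x hx]

/-- The quadrature error, as a linear functional on polynomials. -/
def defect (S : Finset ℝ) : ℝ[X] →ₗ[ℝ] ℝ := unitIntegral - quad S

lemma defect_apply (S : Finset ℝ) (q : ℝ[X]) : defect S q = unitIntegral q - quad S q := rfl

lemma quad_eq_unitIntegral {S : Finset ℝ} {q : ℝ[X]} (hq : q.degree < S.card) :
    quad S q = unitIntegral q := by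
  conv_rhs => rw [Lagrange.eq_interpolate (v := id) Function.injective_id.injOn hq,
    Lagrange.interpolate_apply, map_sum]
  refine Finset.sum_congr rfl fun x _ => ?_
  rw [← smul_eq_C_mul, map_smul, smul_eq_mul, mul_comm]
  rfl

lemma defect_eq_zero {S : Finset ℝ} {q : ℝ[X]} (hq : q.degree < S.card) : defect S q = 0 := by
  rw [defect_apply, quad_eq_unitIntegral hq, sub_self]

/-- Only the values of `r` on the nodes matter, so `r` may be the square of a Lagrange basis
polynomial; this is how positivity of the Gauss weights is obtained. -/
lemma weight_eq_quad {S : Finset ℝ} {x : ℝ} (hx : x ∈ S) (r : ℝ[X])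
    (hr : ∀ y ∈ S, r.eval y = if y = x then 1 else 0) : weight S x = quad S r := by
  rw [quad_apply, Finset.sum_eq_single x]
  · simp [hr x hx]
  · intro y hy hyx
    simp [hr y hy, hyx]
  · exact fun h => absurd hx h

/-! ### Chebyshev polynomials on the unit interval -/

/-- The Chebyshev polynomial `T_k` transplanted to `[0, 1]`. -/
def shiftedT (k : ℤ) : ℝ[X] := (Chebyshev.T ℝ k).comp (2 * X - 1)

lemma eval_shiftedT (k : ℤ) (x : ℝ) :
    (shiftedT k).eval x = (Chebyshev.T ℝ k).eval (2 * x - 1) := by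
  simp [shiftedT, eval_comp]

lemma shiftedT_zero : shiftedT 0 = 1 := by simp [shiftedT]

lemma shiftedT_neg (k : ℤ) : shiftedT (-k) = shiftedT k := by rw [shiftedT, Chebyshev.T_neg]; rfl

lemma shiftedT_natAbs (k : ℤ) : shiftedT k.natAbs = shiftedT k := by
  rw [shiftedT, Chebyshev.T_natAbs]; rfl

lemma degree_shiftedT_le (k : ℕ) : (shiftedT k).degree ≤ k := by
  have h2 : (2 * X - 1 : ℝ[X]).natDegree ≤ 1 := by
    have : (2 * X - 1 : ℝ[X]) = C 2 * X + C (-1) := by simp [sub_eq_add_neg, map_ofNat]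
    rw [this]
    exact natDegree_linear_le
  refine degree_le_of_natDegree_le (natDegree_comp_le.trans ?_)
  rw [Chebyshev.natDegree_T]
  simpa using Nat.mul_le_mul_left k h2

lemma X_mul_shiftedT (k : ℤ) :
    X * shiftedT k = (1 / 2 : ℝ) • shiftedT k +
      (1 / 4 : ℝ) • (shiftedT (k + 1) + shiftedT (k - 1)) := by
  have h := congrArg (fun q : ℝ[X] => q.comp (2 * X - 1)) (Chebyshev.T_add_one ℝ k)
  simp only [sub_comp, mul_comp, X_comp, ofNat_comp] at h
  change shiftedT (k + 1) = 2 * (2 * X - 1) * shiftedT k - shiftedT (k - 1) at h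
  rw [h]
  refine Polynomial.funext fun x => ?_
  simp only [eval_mul, eval_add, eval_sub, eval_smul, eval_X, eval_ofNat, eval_one, smul_eq_mul]
  ring

lemma one_sub_X_mul_shiftedT (k : ℤ) :
    (1 - X) * shiftedT k = (1 / 2 : ℝ) • shiftedT k -
      (1 / 4 : ℝ) • (shiftedT (k + 1) + shiftedT (k - 1)) := by
  rw [sub_mul, one_mul, X_mul_shiftedT]
  module

lemma abs_eval_shiftedT_le_one (k : ℤ) {x : ℝ} (hx : x ∈ Set.Icc (0 : ℝ) 1) :
    |(shiftedT k).eval x| ≤ 1 := by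
  rw [eval_shiftedT, ← Real.cos_arccos (x := 2 * x - 1) (by linarith [hx.1]) (by linarith [hx.2]),
    Chebyshev.T_real_cos]
  exact Real.abs_cos_le_one _

lemma abs_unitIntegral_shiftedT_le_one (k : ℤ) : |unitIntegral (shiftedT k)| ≤ 1 :=
  abs_unitIntegral_le_one fun _ hx => abs_eval_shiftedT_le_one k hx

lemma eval_one_shiftedT (k : ℤ) : (shiftedT k).eval 1 = 1 := by
  rw [eval_shiftedT, show (2 * 1 - 1 : ℝ) = 1 by norm_num, Chebyshev.T_eval_one]

lemma eval_zero_shiftedT (k : ℤ) : (shiftedT k).eval 0 = (k.negOnePow : ℤ) := by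
  rw [eval_shiftedT, show (2 * 0 - 1 : ℝ) = -1 by norm_num, Chebyshev.T_eval_neg_one]

lemma derivative_shiftedT (k : ℤ) :
    derivative (shiftedT k) =
      (2 * k : ℝ) • (Chebyshev.U ℝ (k - 1)).comp (2 * X - 1) := by
  rw [shiftedT, derivative_comp, Chebyshev.T_derivative_eq_U]
  refine Polynomial.funext fun x => ?_
  simp
  ring

/-- An explicit antiderivative from `2 T_k = U_k - U_{k-2}`; the other factor 2 is the chain rule
for `2 x - 1`. The case `k = 1` is excluded by the denominator `k - 1`. -/
lemma derivative_eq_four_smul_shiftedT {k : ℕ} (hk : 2 ≤ k) :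
    derivative ((1 / (k + 1) : ℝ) • shiftedT (k + 1) - (1 / (k - 1) : ℝ) • shiftedT (k - 1)) =
      (4 : ℝ) • shiftedT k := by
  have hk' : (2 : ℝ) ≤ k := by exact_mod_cast hk
  have h := congrArg (fun q : ℝ[X] => q.comp (2 * X - 1)) (Chebyshev.two_mul_T_eq_U_sub_U ℝ (k - 2))
  simp only [sub_comp, mul_comp, ofNat_comp, sub_add_cancel] at h
  change 2 * shiftedT k = _ at h
  rw [derivative_sub, derivative_smul, derivative_smul, derivative_shiftedT, derivative_shiftedT,
    smul_smul, smul_smul, show (4 : ℝ) • shiftedT k = (2 : ℝ) • (2 * shiftedT k) by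
      rw [two_mul]; module, h, smul_sub]
  have e1 : (1 / (k + 1) : ℝ) * (2 * ((k + 1 : ℤ) : ℝ)) = 2 := by push_cast; field_simp
  have e2 : (1 / (k - 1) : ℝ) * (2 * ((k - 1 : ℤ) : ℝ)) = 2 := by
    have : (k - 1 : ℝ) ≠ 0 := by linarith
    push_cast; field_simp
  rw [e1, e2, show (k + 1 - 1 : ℤ) = k by ring, show (k - 1 - 1 : ℤ) = k - 2 by ring]

lemma unitIntegral_shiftedT_odd {k : ℕ} (hk : Odd k) : unitIntegral (shiftedT k) = 0 := by
  rcases eq_or_ne k 1 with rfl | h1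
  · have : shiftedT (1 : ℕ) = derivative (X ^ 2 - X) := by
      simp [shiftedT]
      norm_num
    rw [this, unitIntegral_derivative]
    simp
  · have h2 : 2 ≤ k := by rcases hk with ⟨m, rfl⟩; omega
    have h := congrArg unitIntegral (derivative_eq_four_smul_shiftedT h2)
    have hp : Even ((k : ℤ) + 1) := by exact_mod_cast hk.add_one
    have hm : Even ((k : ℤ) - 1) := by
      have : Odd (k : ℤ) := by exact_mod_cast hk
      exact this.sub_odd odd_one
    rw [unitIntegral_derivative, map_smul] at h
    simp only [eval_sub, eval_smul, eval_one_shiftedT, eval_zero_shiftedT,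
      Int.negOnePow_even _ hp, Int.negOnePow_even _ hm] at h
    simpa using h.symm

lemma unitIntegral_shiftedT_even {k : ℕ} (hk : Even k) (h2 : 2 ≤ k) :
    unitIntegral (shiftedT k) = -1 / ((k : ℝ) ^ 2 - 1) := by
  have h := congrArg unitIntegral (derivative_eq_four_smul_shiftedT h2)
  have hk' : (2 : ℝ) ≤ k := by exact_mod_cast h2
  have hk1 : (k : ℝ) - 1 ≠ 0 := by linarith
  have hk3 : (k : ℝ) ^ 2 - 1 ≠ 0 := by nlinarith
  have he : Even (k : ℤ) := by exact_mod_cast hk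
  have hp : Odd ((k : ℤ) + 1) := he.add_one
  have hm : Odd ((k : ℤ) - 1) := he.sub_odd odd_one
  rw [unitIntegral_derivative, map_smul] at h
  simp only [eval_sub, eval_smul, eval_one_shiftedT, eval_zero_shiftedT,
    Int.negOnePow_odd _ hp, Int.negOnePow_odd _ hm] at h
  simp only [smul_eq_mul, Units.val_neg, Units.val_one, Int.cast_neg, Int.cast_one] at h
  have h4 : unitIntegral (shiftedT k) = (1 / (k + 1) - 1 / (k - 1)) / 2 := by linarith
  rw [h4]
  field_simp
  ring

lemma abs_unitIntegral_shiftedT_le {k m : ℕ} (hm : 2 ≤ m) (hmk : m ≤ k) :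
    |unitIntegral (shiftedT k)| ≤ 1 / ((m : ℝ) ^ 2 - 1) := by
  have hm' : (2 : ℝ) ≤ m := by exact_mod_cast hm
  have hmk' : (m : ℝ) ≤ k := by exact_mod_cast hmk
  have h1 : (0 : ℝ) < (m : ℝ) ^ 2 - 1 := by nlinarith
  rcases k.even_or_odd with hk | hk
  · rw [unitIntegral_shiftedT_even hk (hm.trans hmk), neg_div, abs_neg,
      abs_of_nonneg (by apply div_nonneg <;> nlinarith)]
    gcongr
  · rw [unitIntegral_shiftedT_odd hk, abs_zero]
    positivity

/-! ### Clenshaw–Curtis quadrature -/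

lemma card_clenshawCurtisNodes {n : ℕ} (hn : 0 < n) : (clenshawCurtisNodes n).card = n + 1 := by
  rw [clenshawCurtisNodes, Finset.card_image_of_injOn, Finset.card_range]
  have hn' : (0 : ℝ) < n := by exact_mod_cast hn
  have hmem : ∀ i ∈ Finset.range (n + 1), (i * Real.pi / n : ℝ) ∈ Set.Icc 0 Real.pi := by
    intro i hi
    have hi' : (i : ℝ) ≤ n := by exact_mod_cast Nat.lt_succ_iff.1 (Finset.mem_range.1 hi)
    refine ⟨by positivity, ?_⟩
    rw [div_le_iff₀ hn', mul_comm]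
    gcongr
  intro i hi j hj hij
  have hcos : Real.cos (i * Real.pi / n) = Real.cos (j * Real.pi / n) := by
    simp only at hij; linarith
  have h := Real.injOn_cos (hmem i hi) (hmem j hj) hcos
  rw [div_left_inj' hn'.ne', mul_left_inj' Real.pi_ne_zero] at h
  exact_mod_cast h

lemma eval_shiftedT_clenshawCurtis (k : ℤ) (n j : ℕ) :
    (shiftedT k).eval ((1 + Real.cos (j * Real.pi / n)) / 2) =
      Real.cos (k * (j * Real.pi / n)) := by
  rw [eval_shiftedT, ← Chebyshev.T_real_cos]
  congr 1
  ring

/-- Aliasing: on the Clenshaw–Curtis nodes, `T_k` and `T_m` agree if `k ≡ ± m` modulo `2 n`. -/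
lemma eval_shiftedT_eq_of_mem {n : ℕ} (hn : 0 < n) {k m : ℤ}
    (h : (2 * n : ℤ) ∣ k - m) {x : ℝ} (hx : x ∈ clenshawCurtisNodes n) :
    (shiftedT k).eval x = (shiftedT m).eval x := by
  obtain ⟨j, -, rfl⟩ := Finset.mem_image.1 hx
  rw [eval_shiftedT_clenshawCurtis, eval_shiftedT_clenshawCurtis]
  obtain ⟨c, hc⟩ := h
  have hn' : (n : ℝ) ≠ 0 := by exact_mod_cast hn.ne'
  have hk : (k : ℝ) = m + 2 * n * c := by
    have : k = m + 2 * n * c := by linarith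
    exact_mod_cast this
  have : (k : ℝ) * (j * Real.pi / n) = m * (j * Real.pi / n) + ((c * j : ℤ) : ℝ) * (2 * Real.pi) := by
    rw [hk]; push_cast; field_simp
  rw [this, Real.cos_add_int_mul_two_pi]

/-- The index `m` is the distance from `k` to the nearest multiple of `2 n`. It has the parity of
`k`, and degree at most `n` makes the rule exact on `T_m`. -/
lemma exists_alias {n : ℕ} (hn : 0 < n) (k : ℕ) :
    ∃ m : ℕ, m ≤ n ∧ (Odd k → Odd m) ∧
      quad (clenshawCurtisNodes n) (shiftedT k) = unitIntegral (shiftedT m) := by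
  have hlt : k % (2 * n) < 2 * n := Nat.mod_lt _ (by omega)
  have hdm := Nat.div_add_mod k (2 * n)
  have hodd : Odd k → Odd (k % (2 * n)) := by
    intro h
    rw [← hdm, mul_assoc] at h
    exact (Nat.odd_add'.1 h).2 (even_two_mul _)
  have key : ∀ m : ℕ, ∀ l : ℤ, m ≤ n → shiftedT m = shiftedT l → (2 * n : ℤ) ∣ k - l →
      quad (clenshawCurtisNodes n) (shiftedT k) = unitIntegral (shiftedT m) := by
    intro m l hm hl hd
    rw [hl, quad_eq_of_eval_eq fun x hx => eval_shiftedT_eq_of_mem hn hd hx, ← hl]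
    apply quad_eq_unitIntegral
    refine (degree_shiftedT_le m).trans_lt ?_
    rw [card_clenshawCurtisNodes hn]
    exact_mod_cast Nat.lt_succ_of_le hm
  have hdm' : (2 * n : ℤ) * (k / (2 * n) : ℕ) + (k % (2 * n) : ℕ) = k := by exact_mod_cast hdm
  rcases le_or_gt (k % (2 * n)) n with h | h
  · exact ⟨_, h, hodd, key _ _ h rfl ⟨(k / (2 * n) : ℕ), by linarith⟩⟩
  -- A residue above `n` is reflected: `k` is congruent to `-m` modulo `2 n`, and `T_{-m} = T_m`.
  · refine ⟨2 * n - k % (2 * n), by omega, fun ho => ?_, key _ (-(2 * n - k % (2 * n) : ℕ)) (by omega)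
      (shiftedT_neg _).symm ⟨(k / (2 * n) : ℕ) + 1, ?_⟩⟩
    · exact Nat.Even.sub_odd hlt.le (even_two_mul n) (hodd ho)
    · rw [Nat.cast_sub hlt.le]
      push_cast at hdm' ⊢
      linarith

lemma defect_clenshawCurtis_odd {n : ℕ} (hn : 0 < n) {k : ℕ} (hk : Odd k) :
    defect (clenshawCurtisNodes n) (shiftedT k) = 0 := by
  obtain ⟨m, -, hm, h⟩ := exists_alias hn k
  rw [defect_apply, h, unitIntegral_shiftedT_odd hk, unitIntegral_shiftedT_odd (hm hk), sub_self]

lemma defect_clenshawCurtis_of_le {n : ℕ} (hn : 0 < n) {k : ℕ} (hk : k ≤ n) :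
    defect (clenshawCurtisNodes n) (shiftedT k) = 0 := by
  refine defect_eq_zero ((degree_shiftedT_le k).trans_lt ?_)
  rw [card_clenshawCurtisNodes hn]
  exact_mod_cast Nat.lt_succ_of_le hk

lemma abs_defect_clenshawCurtis_le {n : ℕ} (hn : 0 < n) {k : ℕ} (hk : 4 ≤ k) :
    |defect (clenshawCurtisNodes n) (shiftedT k)| ≤ 16 / 15 := by
  obtain ⟨m, -, -, h⟩ := exists_alias hn k
  have h1 := abs_unitIntegral_shiftedT_le (by norm_num : 2 ≤ 4) hk
  have h2 := abs_unitIntegral_shiftedT_le_one m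
  rw [defect_apply, h]
  refine (abs_sub _ _).trans ?_
  norm_num at h1
  linarith

/-- Here the alias is `T_{n-1}`, as `(n + 1) + (n - 1) = 2 n`. Both integrals are at most 1/15
because `4 ≤ n - 1`, which beats the generic bound 16/15. -/
lemma abs_defect_clenshawCurtis_succ_le {n : ℕ} (hn : 5 ≤ n) :
    |defect (clenshawCurtisNodes n) (shiftedT (n + 1 : ℕ))| ≤ 2 / 15 := by
  have h : quad (clenshawCurtisNodes n) (shiftedT (n + 1 : ℕ)) =
      unitIntegral (shiftedT (n - 1 : ℕ)) := by
    rw [← shiftedT_neg (n - 1 : ℕ), quad_eq_of_eval_eq fun x hx =>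
      eval_shiftedT_eq_of_mem (by omega) (m := -(n - 1 : ℕ)) ⟨1, ?_⟩ hx, shiftedT_neg,
      quad_eq_unitIntegral]
    · refine (degree_shiftedT_le _).trans_lt ?_
      rw [card_clenshawCurtisNodes (by omega)]
      exact_mod_cast (by omega : n - 1 < n + 1)
    · push_cast [Nat.cast_sub (by omega : 1 ≤ n)]
      ring
  have h1 := abs_unitIntegral_shiftedT_le (by norm_num : 2 ≤ 4) (by omega : 4 ≤ n + 1)
  have h2 := abs_unitIntegral_shiftedT_le (by norm_num : 2 ≤ 4) (by omega : 4 ≤ n - 1)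
  rw [defect_apply, h]
  refine (abs_sub _ _).trans ?_
  norm_num at h1 h2 ⊢
  linarith

/-! ### Orthogonality of the shifted Legendre polynomials -/

/-- Repeated integration by parts, in the situation of Rodrigues' formula. -/
lemma unitIntegral_iterate_derivative_mul {g : ℝ[X]} {N : ℕ}
    (h0 : ∀ i < N, (derivative^[i] g).eval 0 = 0) (h1 : ∀ i < N, (derivative^[i] g).eval 1 = 0) :
    ∀ j ≤ N, ∀ s : ℝ[X], s.degree < j → unitIntegral (derivative^[j] g * s) = 0 := by
  intro j
  induction j with
  | zero =>
    intro _ s hs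
    rw [Nat.cast_zero, ← not_le, zero_le_degree_iff, not_not] at hs
    simp [hs]
  | succ j ih =>
    intro hj s hs
    have hd : derivative (derivative^[j] g * s) =
        derivative^[j + 1] g * s + derivative^[j] g * derivative s := by
      rw [derivative_mul, Function.iterate_succ_apply']
    have hs' : (derivative s).degree < j := by
      rcases eq_or_ne s 0 with rfl | hs0
      · simp
      · rw [← natDegree_lt_iff_degree_lt hs0] at hs
        exact (degree_derivative_lt hs0).trans_le
          (degree_le_of_natDegree_le (Nat.lt_succ_iff.1 hs))
    have h := unitIntegral_derivative (derivative^[j] g * s)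
    rw [hd, map_add, ih (by omega) _ hs', add_zero, eval_mul, eval_mul, h0 j hj, h1 j hj] at h
    simpa using h

/-- The shifted Legendre polynomial with real coefficients. -/
def legendre (n : ℕ) : ℝ[X] := (shiftedLegendre n).map (Int.castRingHom ℝ)

lemma degree_legendre (n : ℕ) : (legendre n).degree = n := by
  rw [legendre, degree_map_eq_of_injective (RingHom.injective_int _), degree_shiftedLegendre]

lemma legendre_ne_zero (n : ℕ) : legendre n ≠ 0 := by
  rw [← degree_ne_bot, degree_legendre]
  exact WithBot.natCast_ne_bot n

lemma factorial_mul_legendre (n : ℕ) :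
    (n ! : ℝ[X]) * legendre n = derivative^[n] (X ^ n * (1 - X) ^ n) := by
  have h := congrArg (Polynomial.map (Int.castRingHom ℝ)) (factorial_mul_shiftedLegendre_eq n)
  rw [← iterate_derivative_map] at h
  simpa [legendre] using h

lemma eval_iterate_derivative_eq_zero {g : ℝ[X]} {N i : ℕ} (hi : i < N) {a : ℝ}
    (h : (X - C a) ^ N ∣ g) : (derivative^[i] g).eval a = 0 := by
  have h1 : (X - C a) ^ (N - i) ∣ derivative^[i] g :=
    pow_sub_dvd_iterate_derivative_of_pow_dvd i h
  exact dvd_iff_isRoot.1 ((dvd_pow_self _ (by omega)).trans h1)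

lemma unitIntegral_legendre_mul {n : ℕ} {s : ℝ[X]} (hs : s.degree < n) :
    unitIntegral (legendre n * s) = 0 := by
  have h := unitIntegral_iterate_derivative_mul (g := X ^ n * (1 - X) ^ n) (N := n)
    (fun i hi => eval_iterate_derivative_eq_zero hi (by simp))
    (fun i hi => eval_iterate_derivative_eq_zero hi (by
      refine Dvd.dvd.mul_left ?_ _
      apply pow_dvd_pow_of_dvd
      exact ⟨-1, by simp⟩)) n le_rfl s hs
  rw [← factorial_mul_legendre, mul_assoc, ← nsmul_eq_mul, map_nsmul, nsmul_eq_mul] at h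
  exact (mul_eq_zero.1 h).resolve_left (by exact_mod_cast n.factorial_ne_zero)

/-- No factor of positive degree of a Legendre polynomial is nonnegative on `[0, 1]`. -/
lemma legendre_ne_mul_of_nonneg {n : ℕ} {g q : ℝ[X]} (hg : 0 < g.degree)
    (hpos : ∀ x ∈ Set.Icc (0 : ℝ) 1, 0 ≤ g.eval x) : legendre n ≠ g * q := by
  intro h
  have hne := legendre_ne_zero n
  have hq0 : q ≠ 0 := by rintro rfl; exact hne (by rw [h, mul_zero])
  have hg0 : g ≠ 0 := by rintro rfl; exact hne (by rw [h, zero_mul])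
  have hdeg : q.degree < n := by
    rw [← degree_legendre n, h, degree_mul, degree_eq_natDegree hq0, degree_eq_natDegree hg0]
    rw [degree_eq_natDegree hg0] at hg
    have : 0 < g.natDegree := by exact_mod_cast hg
    exact_mod_cast (by omega : q.natDegree < g.natDegree + q.natDegree)
  -- The cofactor `q` has degree below `n`, so orthogonality gives `∫ g q ^ 2 = 0` with a
  -- nonnegative integrand.
  have hint := unitIntegral_legendre_mul hdeg
  rw [h] at hint
  have hz := eq_zero_of_unitIntegral_eq_zero (fun x hx => ?_) hint
  · simp [hg0, hq0] at hz
  · have := mul_nonneg (hpos x hx) (mul_self_nonneg (q.eval x))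
    simpa [mul_assoc] using this

lemma mem_Icc_of_isRoot_legendre {n : ℕ} {a : ℝ} (ha : (legendre n).IsRoot a) :
    a ∈ Set.Icc (0 : ℝ) 1 := by
  obtain ⟨q, hq⟩ := dvd_iff_isRoot.2 ha
  by_contra hout
  rw [Set.mem_Icc, not_and_or, not_le, not_le] at hout
  rcases hout with hlt | hgt
  · refine legendre_ne_mul_of_nonneg (by simp) (fun x hx => ?_) hq
    simp only [eval_sub, eval_X, eval_C]
    linarith [hx.1]
  · refine legendre_ne_mul_of_nonneg (g := -(X - C a)) (q := -q) ?_ (fun x hx => ?_)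
      (by rw [hq, neg_mul_neg])
    · rw [degree_neg, degree_X_sub_C]
      exact zero_lt_one
    · simp only [eval_neg, eval_sub, eval_X, eval_C]
      linarith [hx.2]

lemma nodup_roots_legendre (n : ℕ) : (legendre n).roots.Nodup := by
  rw [Multiset.nodup_iff_count_le_one]
  intro a
  rw [count_roots]
  by_contra! hlt
  obtain ⟨q, hq⟩ := (pow_dvd_pow (X - C a) hlt).trans (pow_rootMultiplicity_dvd (legendre n) a)
  refine legendre_ne_mul_of_nonneg ?_ (fun x _ => ?_) hq
  · rw [degree_pow, degree_X_sub_C]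
    norm_num
  · simpa using sq_nonneg (x - a)

/-- A cofactor `q` without real roots but of positive degree would have a nonreal root, hence
contain a real quadratic factor that is positive on the line. -/
lemma card_roots_legendre (n : ℕ) : Multiset.card (legendre n).roots = n := by
  obtain ⟨q, hq, hcard, hroots⟩ := exists_prod_multiset_X_sub_C_mul (legendre n)
  rw [natDegree_eq_of_degree_eq_some (degree_legendre n)] at hcard
  have hdvd : q ∣ legendre n := ⟨_, by rw [mul_comm]; exact hq.symm⟩
  have hq0 : q ≠ 0 := ne_zero_of_dvd_ne_zero (legendre_ne_zero n) hdvd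
  suffices q.natDegree = 0 by omega
  by_contra hdeg
  obtain ⟨z, hz⟩ := IsAlgClosed.exists_aeval_eq_zero ℂ q (by
    rw [degree_eq_natDegree hq0]
    exact_mod_cast hdeg)
  rcases eq_or_ne z.im 0 with him | him
  · have hzre : z = ((z.re : ℝ) : ℂ) := by apply Complex.ext <;> simp [him]
    have hroot : q.IsRoot z.re := by
      rw [hzre, ← Complex.coe_algebraMap, aeval_algebraMap_apply_eq_algebraMap_eval] at hz
      exact (algebraMap ℝ ℂ).injective (hz.trans (map_zero _).symm)
    have := (mem_roots hq0).2 hroot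
    rw [hroots] at this
    simp at this
  · obtain ⟨r, hr⟩ := (quadratic_dvd_of_aeval_eq_zero_im_ne_zero q hz him).trans hdvd
    refine legendre_ne_mul_of_nonneg ?_ (fun x _ => ?_) hr
    · have : (X ^ 2 - C (2 * z.re) * X + C (‖z‖ ^ 2) : ℝ[X]) =
          C 1 * X ^ 2 + C (-(2 * z.re)) * X + C (‖z‖ ^ 2) := by
        simp [sub_eq_add_neg]
      rw [this, degree_quadratic one_ne_zero]
      norm_num
    -- At real `x` the quadratic equals `(x - z.re) ^ 2 + z.im ^ 2`.
    · have hn : ‖z‖ ^ 2 = z.re ^ 2 + z.im ^ 2 := by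
        rw [Complex.sq_norm, Complex.normSq_apply]; ring
      simp only [eval_add, eval_sub, eval_mul, eval_pow, eval_X, eval_C, hn]
      nlinarith [sq_nonneg (x - z.re), sq_nonneg z.im]

/-! ### Gauss quadrature -/

lemma gaussNodes_eq (n : ℕ) : gaussNodes n = (legendre (n + 1)).roots.toFinset := rfl

lemma mem_gaussNodes {n : ℕ} {x : ℝ} : x ∈ gaussNodes n ↔ (legendre (n + 1)).eval x = 0 := by
  rw [gaussNodes_eq, Multiset.mem_toFinset, mem_roots (legendre_ne_zero _), IsRoot.def]

lemma card_gaussNodes (n : ℕ) : (gaussNodes n).card = n + 1 := by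
  rw [gaussNodes_eq, Multiset.toFinset_card_of_nodup (nodup_roots_legendre _), card_roots_legendre]

/-- The `(n + 1)`-point Gauss rule is exact up to degree `2 n + 1`. -/
lemma defect_gauss_eq_zero {n : ℕ} {q : ℝ[X]} (hq : q.natDegree ≤ 2 * n + 1) :
    defect (gaussNodes n) q = 0 := by
  set P := legendre (n + 1) with hP
  have hP0 : P ≠ 0 := legendre_ne_zero _
  have hPd : P.natDegree = n + 1 := natDegree_eq_of_degree_eq_some (degree_legendre _)
  have hdm : P * (q / P) + q % P = q := EuclideanDomain.div_add_mod q P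
  have hmod : (q % P).degree < (n + 1 : ℕ) := by
    have := degree_mod_lt q hP0
    rwa [hP, degree_legendre] at this
  have hdiv : (q / P).degree < (n + 1 : ℕ) := by
    have h : (q / P).natDegree ≤ q.natDegree - (n + 1) := by
      rw [div_def]
      refine (natDegree_C_mul_le _ _).trans ?_
      rw [natDegree_divByMonic _ (monic_mul_leadingCoeff_inv hP0),
        natDegree_mul_leadingCoeff_inv _ hP0, hPd]
    exact degree_le_natDegree.trans_lt (by exact_mod_cast (by omega : (q / P).natDegree < n + 1))
  have hquad : quad (gaussNodes n) q = quad (gaussNodes n) (q % P) :=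
    quad_eq_of_eval_eq fun x hx => by
      conv_lhs => rw [← hdm, eval_add, eval_mul, mem_gaussNodes.1 hx, zero_mul, zero_add]
  rw [defect_apply, hquad, quad_eq_unitIntegral (by rwa [card_gaussNodes])]
  conv_lhs => rw [← hdm]
  rw [map_add, unitIntegral_legendre_mul hdiv, zero_add, hdm, sub_self]

lemma quad_gauss {n : ℕ} {q : ℝ[X]} (hq : q.natDegree ≤ 2 * n + 1) :
    quad (gaussNodes n) q = unitIntegral q := by
  have := defect_gauss_eq_zero hq
  rw [defect_apply] at this
  linarith

/-- The squared Lagrange basis polynomial has degree `2 n`, within the exactness range, so the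
weight is the integral of a square. -/
lemma weight_gauss_nonneg {n : ℕ} {x : ℝ} (hx : x ∈ gaussNodes n) :
    0 ≤ weight (gaussNodes n) x := by
  have hinj : Set.InjOn (id : ℝ → ℝ) (gaussNodes n) := Function.injective_id.injOn
  have hdeg : (Lagrange.basis (gaussNodes n) id x).natDegree = n := by
    rw [Lagrange.natDegree_basis hinj hx, card_gaussNodes]; rfl
  rw [weight_eq_quad hx (Lagrange.basis (gaussNodes n) id x ^ 2), quad_gauss]
  · exact unitIntegral_nonneg fun y _ => by rw [eval_pow]; positivity
  · rw [natDegree_pow, hdeg]; omega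
  · intro y hy
    split_ifs with h
    · subst h
      have := Lagrange.eval_basis_self hinj hx
      simp only [id] at this
      rw [eval_pow]
      erw [this]
      norm_num
    · have := Lagrange.eval_basis_of_ne (v := (id : ℝ → ℝ)) (Ne.symm h) hy
      simp only [id] at this
      rw [eval_pow]
      erw [this]
      norm_num

lemma abs_quad_gauss_le_one {n : ℕ} {q : ℝ[X]} (hq : ∀ x ∈ Set.Icc (0 : ℝ) 1, |q.eval x| ≤ 1) :
    |quad (gaussNodes n) q| ≤ 1 := by
  have h1 : ∑ x ∈ gaussNodes n, weight (gaussNodes n) x = 1 := by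
    have h := quad_gauss (n := n) (q := 1) (by simp)
    simpa [quad_apply, unitIntegral_apply] using h
  rw [quad_apply, ← h1]
  refine (Finset.abs_sum_le_sum_abs _ _).trans (Finset.sum_le_sum fun x hx => ?_)
  rw [abs_mul, abs_of_nonneg (weight_gauss_nonneg hx)]
  exact mul_le_of_le_one_right (weight_gauss_nonneg hx)
    (hq x (mem_Icc_of_isRoot_legendre (mem_gaussNodes.1 hx)))

lemma defect_gauss_of_le {n k : ℕ} (hk : k ≤ 2 * n + 1) :
    defect (gaussNodes n) (shiftedT k) = 0 :=
  defect_gauss_eq_zero ((natDegree_le_of_degree_le (degree_shiftedT_le k)).trans hk)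

lemma abs_defect_gauss_le {n k : ℕ} (hk : 4 ≤ k) :
    |defect (gaussNodes n) (shiftedT k)| ≤ 16 / 15 := by
  have h1 := abs_unitIntegral_shiftedT_le (by norm_num : 2 ≤ 4) hk
  have h2 := abs_quad_gauss_le_one (n := n) (q := shiftedT k) fun _ hx =>
    abs_eval_shiftedT_le_one k hx
  rw [defect_apply]
  refine (abs_sub _ _).trans ?_
  norm_num at h1
  linarith

/-! ### Majorization on Bernstein ellipses -/

/-- The value of `T_k` at the end point `(ρ + ρ⁻¹) / 2` of the Bernstein ellipse. -/
def ellipseWeight (ρ : ℝ) (k : ℤ) : ℝ := (ρ ^ k + ρ ^ (-k)) / 2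

lemma ellipseWeight_natAbs (ρ : ℝ) (k : ℤ) : ellipseWeight ρ k.natAbs = ellipseWeight ρ k := by
  rcases Int.natAbs_eq k with h | h
  · rw [← h]
  · conv_rhs => rw [h]
    simp only [ellipseWeight, neg_neg]
    rw [add_comm]

lemma ellipseWeight_add_sub {ρ : ℝ} (hρ : 0 < ρ) (k : ℤ) :
    ellipseWeight ρ (k + 1) + ellipseWeight ρ (k - 1) = (ρ + ρ⁻¹) * ellipseWeight ρ k := by
  have h := hρ.ne'
  simp only [ellipseWeight, neg_add, neg_sub]
  rw [zpow_add₀ h, zpow_sub₀ h, zpow_add₀ h, zpow_sub₀ h, zpow_neg, zpow_neg]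
  simp only [zpow_one]
  field_simp
  ring

/-- A linear functional dominated on Chebyshev polynomials by the weights of a Bernstein ellipse
is dominated on the products `x ^ p (1 - x) ^ j` by the maximum of `|x| ^ (p + j)` there. -/
lemma abs_apply_le_of_shiftedT_le {L : ℝ[X] →ₗ[ℝ] ℝ} {ρ K : ℝ} (hρ : 0 < ρ)
    (h : ∀ k : ℤ, |L (shiftedT k)| ≤ K * ellipseWeight ρ k) (p j : ℕ) :
    |L (X ^ p * (1 - X) ^ j)| ≤ K * ((2 + ρ + ρ⁻¹) / 4) ^ (p + j) := by
  set W := (2 + ρ + ρ⁻¹) / 4 with hW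
  have step : ∀ (B : ℝ) (a b c : ℝ) (k : ℤ), |a| ≤ B * ellipseWeight ρ k →
      |b| ≤ B * ellipseWeight ρ (k + 1) → |c| ≤ B * ellipseWeight ρ (k - 1) →
      1 / 2 * |a| + 1 / 4 * (|b| + |c|) ≤ B * W * ellipseWeight ρ k := by
    intro B a b c k ha hb hc
    have := ellipseWeight_add_sub hρ k
    have h2 : B * W * ellipseWeight ρ k = 1 / 2 * (B * ellipseWeight ρ k) +
        1 / 4 * (B * (ellipseWeight ρ (k + 1) + ellipseWeight ρ (k - 1))) := by
      rw [this, hW]; ring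
    rw [h2, mul_add B]
    linarith
  have tri : ∀ a b c : ℝ, |(1 / 2) * a + (1 / 4) * (b + c)| ≤ 1 / 2 * |a| + 1 / 4 * (|b| + |c|) ∧
      |(1 / 2) * a - (1 / 4) * (b + c)| ≤ 1 / 2 * |a| + 1 / 4 * (|b| + |c|) := by
    intro a b c
    constructor <;> rw [abs_le] <;> constructor <;>
      linarith [neg_abs_le a, le_abs_self a, neg_abs_le b, le_abs_self b, neg_abs_le c,
        le_abs_self c]
  -- The bound is carried for all integers `k`, since each multiplication calls on the neighbours `k
  -- + 1` and `k - 1`. The sign pattern for `1 - X` is irrelevant after the triangle inequality.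
  have hj : ∀ (j : ℕ) (k : ℤ), |L ((1 - X) ^ j * shiftedT k)| ≤ K * W ^ j * ellipseWeight ρ k := by
    intro j
    induction j with
    | zero => simpa using h
    | succ j ih =>
      intro k
      rw [pow_succ, mul_assoc, one_sub_X_mul_shiftedT, mul_sub, mul_smul_comm, mul_smul_comm,
        mul_add, map_sub, map_smul, map_smul, map_add, smul_eq_mul, smul_eq_mul, pow_succ,
        ← mul_assoc]
      exact (tri _ _ _).2.trans (step _ _ _ _ k (ih _) (ih _) (ih _))
  have hp : ∀ (p : ℕ) (k : ℤ),
      |L (X ^ p * ((1 - X) ^ j * shiftedT k))| ≤ K * W ^ (p + j) * ellipseWeight ρ k := by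
    intro p
    induction p with
    | zero => simpa using hj j
    | succ p ih =>
      intro k
      have hx : X ^ (p + 1) * ((1 - X) ^ j * shiftedT k) =
          (1 / 2 : ℝ) • (X ^ p * ((1 - X) ^ j * shiftedT k)) +
            (1 / 4 : ℝ) • (X ^ p * ((1 - X) ^ j * shiftedT (k + 1)) +
              X ^ p * ((1 - X) ^ j * shiftedT (k - 1))) := by
        rw [pow_succ, mul_assoc, mul_left_comm X, X_mul_shiftedT]
        simp only [mul_add, mul_smul_comm]
      rw [hx, map_add, map_smul, map_smul, map_add, smul_eq_mul, smul_eq_mul, add_right_comm,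
        pow_succ W, ← mul_assoc K]
      exact (tri _ _ _).1.trans (step _ _ _ _ k (ih _) (ih _) (ih _))
  have h0 := hp p 0
  rw [shiftedT_zero, mul_one] at h0
  simpa [ellipseWeight] using h0

/-- The number `1 + √2` is the positive root of `ρ ^ 2 - 2 ρ - 1`; this is the origin of the
threshold on `n`. -/
lemma two_add_add_inv_div_le {ρ : ℝ} (hρ : 1 + √2 ≤ ρ) : (2 + ρ + ρ⁻¹) / 4 ≤ ρ / 2 := by
  have h2 : √2 ^ 2 = 2 := Real.sq_sqrt (by norm_num)
  have h0 : 0 < ρ := lt_of_lt_of_le (by positivity) hρ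
  have : 2 + ρ⁻¹ ≤ ρ := by
    rw [← sub_nonneg]
    have : ρ - (2 + ρ⁻¹) = (ρ ^ 2 - 2 * ρ - 1) / ρ := by field_simp; ring
    rw [this]
    apply div_nonneg _ h0.le
    nlinarith [Real.sqrt_nonneg 2]
  linarith

lemma one_add_sqrt_two_sq_ge {ρ : ℝ} (hρ : 1 + √2 ≤ ρ) : 29 / 5 ≤ ρ ^ 2 := by
  have h2 : (7 / 5 : ℝ) ≤ √2 := Real.le_sqrt_of_sq_le (by norm_num)
  have h3 : √2 ^ 2 = 2 := Real.sq_sqrt (by norm_num)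
  nlinarith

lemma abs_defect_monomial_le {S : Finset ℝ} {ρ K : ℝ} (hρ : 1 + √2 ≤ ρ) (hK : 0 ≤ K)
    (h : ∀ k : ℕ, |defect S (shiftedT k)| ≤ K * ρ ^ k / 2) (p j : ℕ) :
    |defect S (X ^ p * (1 - X) ^ j)| ≤ K * (ρ / 2) ^ (p + j) := by
  have h0 : 0 < ρ := lt_of_lt_of_le (by positivity) hρ
  refine (abs_apply_le_of_shiftedT_le (K := K) h0 (fun k => ?_) p j).trans ?_
  · rw [← shiftedT_natAbs, ← ellipseWeight_natAbs]
    refine (h k.natAbs).trans ?_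
    rw [ellipseWeight, zpow_natCast, mul_div_assoc]
    gcongr
    exact le_add_of_nonneg_right (by positivity)
  · exact mul_le_mul_of_nonneg_left
      (pow_le_pow_left₀ (by positivity) (two_add_add_inv_div_le hρ) _) hK

/-- With `K = ρ ^ (-m) / 2`, two degrees beyond `m` leave room `ρ ^ 2 / 4`, at least 29/20 and so
above 16/15. -/
lemma le_mul_pow_div_two {ρ : ℝ} (hρ : 1 + √2 ≤ ρ) {m k : ℕ} (hk : m + 2 ≤ k) :
    29 / 20 ≤ (1 / 2 * (ρ ^ m)⁻¹) * ρ ^ k / 2 := by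
  have h0 : 1 ≤ ρ := le_trans (by linarith [Real.sqrt_nonneg 2]) hρ
  have h1 : (0 : ℝ) < ρ ^ m := by positivity
  have h2 : ρ ^ (m + 2) ≤ ρ ^ k := pow_le_pow_right₀ h0 hk
  have h3 := one_add_sqrt_two_sq_ge hρ
  have h4 : (1 / 2 * (ρ ^ m)⁻¹) * ρ ^ (m + 2) / 2 = ρ ^ 2 / 4 := by
    rw [pow_add]; field_simp; norm_num
  calc (29 / 20 : ℝ) ≤ ρ ^ 2 / 4 := by linarith
    _ = (1 / 2 * (ρ ^ m)⁻¹) * ρ ^ (m + 2) / 2 := h4.symm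
    _ ≤ _ := by gcongr

lemma abs_defect_clenshawCurtis_even {n : ℕ} (hn : 4 ≤ n) (he : Even n) {ρ : ℝ}
    (hρ : 1 + √2 ≤ ρ) (k : ℕ) :
    |defect (clenshawCurtisNodes n) (shiftedT k)| ≤ (1 / 2 * (ρ ^ n)⁻¹) * ρ ^ k / 2 := by
  have h0 : 0 < ρ := lt_of_lt_of_le (by positivity) hρ
  rcases le_or_gt k n with hk | hk
  · rw [defect_clenshawCurtis_of_le (by omega) hk, abs_zero]; positivity
  rcases k.even_or_odd with hke | hko
  · have : n + 2 ≤ k := by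
      rcases he with ⟨a, rfl⟩; rcases hke with ⟨b, rfl⟩; omega
    exact (abs_defect_clenshawCurtis_le (by omega) (by omega)).trans
      (le_trans (by norm_num) (le_mul_pow_div_two hρ this))
  · rw [defect_clenshawCurtis_odd (by omega) hko, abs_zero]; positivity

lemma abs_defect_gauss {n : ℕ} (hn : 2 ≤ n) {ρ : ℝ} (hρ : 1 + √2 ≤ ρ) (k : ℕ) :
    |defect (gaussNodes n) (shiftedT k)| ≤ (1 / 2 * (ρ ^ (2 * n))⁻¹) * ρ ^ k / 2 := by
  have h0 : 0 < ρ := lt_of_lt_of_le (by positivity) hρ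
  rcases le_or_gt k (2 * n + 1) with hk | hk
  · rw [defect_gauss_of_le hk, abs_zero]; positivity
  · exact (abs_defect_gauss_le (by omega)).trans
      (le_trans (by norm_num) (le_mul_pow_div_two hρ (by omega)))

/-- The extra factor `e⁻¹` is reserved to pay for the non-optimal ellipse in
`bound_shifted_ellipse`. -/
lemma abs_defect_clenshawCurtis_of_odd {n : ℕ} (hn : 5 ≤ n) (ho : Odd n) {ρ : ℝ}
    (hρ : 1 + √2 ≤ ρ) (k : ℕ) :
    |defect (clenshawCurtisNodes n) (shiftedT k)| ≤
      (1 / 2 * ((Real.exp 1)⁻¹ * (ρ ^ (n - 1))⁻¹)) * ρ ^ k / 2 := by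
  have h0 : 0 < ρ := lt_of_lt_of_le (by positivity) hρ
  have he : (1 / 3 : ℝ) ≤ (Real.exp 1)⁻¹ := by
    rw [one_div]
    exact inv_anti₀ (Real.exp_pos 1) (Real.exp_one_lt_d9.le.trans (by norm_num))
  have hform : (1 / 2 * ((Real.exp 1)⁻¹ * (ρ ^ (n - 1))⁻¹)) * ρ ^ k / 2 =
      (Real.exp 1)⁻¹ * ((1 / 2 * (ρ ^ (n - 1))⁻¹) * ρ ^ k / 2) := by ring
  rcases le_or_gt k n with hk | hk
  · rw [defect_clenshawCurtis_of_le (by omega) hk, abs_zero]; positivity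
  rcases k.even_or_odd with hke | hko
  swap
  · rw [defect_clenshawCurtis_odd (by omega) hko, abs_zero]; positivity
  rw [hform]
  -- At `k = n + 1` only `29/20 * 1/3` is available, too little for 16/15 but enough for 2/15. Later
  -- even `k` are at least `n + 3` and gain another factor `ρ ^ 2`.
  rcases eq_or_ne k (n + 1) with rfl | hne
  · have h1 := le_mul_pow_div_two hρ (by omega : n - 1 + 2 ≤ n + 1)
    refine (abs_defect_clenshawCurtis_succ_le hn).trans ?_
    refine le_trans ?_ (mul_le_mul he h1 (by norm_num) (by positivity))
    norm_num
  · have hk3 : n + 1 + 2 ≤ k := by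
      rcases ho with ⟨a, rfl⟩; rcases hke with ⟨b, rfl⟩; omega
    have h1 := le_mul_pow_div_two hρ hk3
    have h2 : (1 / 2 * (ρ ^ (n - 1))⁻¹) * ρ ^ k / 2 =
        ρ ^ 2 * ((1 / 2 * (ρ ^ (n + 1))⁻¹) * ρ ^ k / 2) := by
      rw [show n + 1 = n - 1 + 2 by omega, pow_add]
      field_simp
    have h3 : 29 / 5 * (29 / 20) ≤ (1 / 2 * (ρ ^ (n - 1))⁻¹) * ρ ^ k / 2 := by
      rw [h2]
      exact mul_le_mul (one_add_sqrt_two_sq_ge hρ) h1 (by norm_num) (by positivity)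
    refine (abs_defect_clenshawCurtis_le (by omega) (by omega)).trans ?_
    refine le_trans ?_ (mul_le_mul he h3 (by norm_num) (by positivity))
    norm_num

/-! ### The quadrature error for `φ`-functions -/

section MatrixNorm

attribute [local instance] Matrix.linftyOpNormedAddCommGroup Matrix.linftyOpNormedSpace
  Matrix.linftyOpNormedRing Matrix.linftyOpNormedAlgebra

variable {𝕜 ι : Type*} [RCLike 𝕜] [Fintype ι]

lemma norm_pow_mulVec_le [DecidableEq ι] (A : Matrix ι ι 𝕜) (b : ι → 𝕜) (l : ℕ) :
    ‖(A ^ l).mulVec b‖ ≤ matrixNormInf A ^ l * ‖b‖ := by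
  induction l with
  | zero => simp
  | succ l ih =>
    rw [pow_succ', ← Matrix.mulVec_mulVec, pow_succ', mul_assoc]
    exact (Matrix.linfty_opNorm_mulVec A _).trans
      (mul_le_mul_of_nonneg_left ih (norm_nonneg A))

lemma hasSum_exp_smul_apply [DecidableEq ι] (A : Matrix ι ι 𝕜) (c : ℝ) (i j : ι) :
    HasSum (fun l : ℕ => (c ^ l / (l ! : ℝ)) • (A ^ l) i j) (NormedSpace.exp (c • A) i j) := by
  have h := NormedSpace.exp_series_hasSum_exp' (𝕂 := ℝ) (c • A)
  have h2 := Pi.hasSum.1 (Pi.hasSum.1 h i) j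
  convert! h2 using 2 with l
  rw [_root_.smul_pow, Matrix.smul_apply, Matrix.smul_apply, smul_smul, div_eq_inv_mul]

lemma continuous_exp_smul_apply [DecidableEq ι] (A : Matrix ι ι 𝕜) (i j : ι) :
    Continuous fun θ : ℝ => NormedSpace.exp ((1 - θ) • A) i j := by
  have h : Continuous fun θ : ℝ => NormedSpace.exp ((1 - θ) • A) :=
    NormedSpace.exp_continuous.comp (by fun_prop)
  exact h.matrix_elem i j

lemma matrixNormInf_nonneg (A : Matrix ι ι 𝕜) : 0 ≤ matrixNormInf A := norm_nonneg A

lemma matrixNormInf_pos {A : Matrix ι ι 𝕜} (hA : A ≠ 0) : 0 < matrixNormInf A := norm_pos_iff.2 hA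

end MatrixNorm

variable {𝕜 ι : Type*} [RCLike 𝕜] [Fintype ι] [DecidableEq ι]

lemma hasSum_exp_smul_mulVec (A : Matrix ι ι 𝕜) (b : ι → 𝕜) (c : ℝ) (i : ι) :
    HasSum (fun l : ℕ => (c ^ l / (l ! : ℝ)) • (A ^ l).mulVec b i)
      ((NormedSpace.exp (c • A)).mulVec b i) := by
  simp only [Matrix.mulVec, dotProduct, Finset.smul_sum, ← smul_mul_assoc]
  exact hasSum_sum fun j _ => (hasSum_exp_smul_apply A c i j).mul_right (b j)

lemma phi_succ_mulVec (p : ℕ) (A : Matrix ι ι 𝕜) (b : ι → 𝕜) (i : ι) :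
    (phi (p + 1) A).mulVec b i = ∫ θ in (0 : ℝ)..1, (θ ^ p / (p ! : ℝ)) •
      (NormedSpace.exp ((1 - θ) • A)).mulVec b i := by
  simp only [Matrix.mulVec, dotProduct, Finset.smul_sum, phi, Matrix.of_apply]
  rw [intervalIntegral.integral_finsetSum]
  · refine Finset.sum_congr rfl fun j _ => ?_
    rw [← intervalIntegral.integral_mul_const]
    simp only [smul_mul_assoc]
  · intro j _
    apply Continuous.intervalIntegrable
    exact ((continuous_id.pow p).div_const _).smul
      ((continuous_exp_smul_apply A i j).mul_const (b j))

lemma summable_pow_mul_pow_div_factorial (x B : ℝ) :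
    Summable fun l : ℕ => x ^ l / (l ! : ℝ) * B :=
  (Real.summable_pow_div_factorial x).mul_right B

lemma hasSum_phi_succ_mulVec (p : ℕ) (A : Matrix ι ι 𝕜) (b : ι → 𝕜) (i : ι) :
    HasSum (fun l : ℕ => (unitIntegral (X ^ p * (1 - X) ^ l) / (p ! * l ! : ℝ)) •
      (A ^ l).mulVec b i) ((phi (p + 1) A).mulVec b i) := by
  rw [phi_succ_mulVec]
  have hterm : ∀ l : ℕ, (unitIntegral (X ^ p * (1 - X) ^ l) / (p ! * l ! : ℝ)) •
      (A ^ l).mulVec b i = ∫ θ in (0 : ℝ)..1, (θ ^ p / (p ! : ℝ)) •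
        (((1 - θ) ^ l / (l ! : ℝ)) • (A ^ l).mulVec b i) := by
    intro l
    simp only [smul_smul]
    rw [intervalIntegral.integral_smul_const, unitIntegral_apply, ← intervalIntegral.integral_div]
    congr 1
    refine intervalIntegral.integral_congr fun θ _ => ?_
    simp
    field_simp
  simp only [hterm]
  refine intervalIntegral.hasSum_integral_of_dominated_convergence
    (fun l _ => matrixNormInf A ^ l / (l ! : ℝ) * ‖b‖) ?_ ?_ ?_ ?_ ?_
  · intro l
    apply Continuous.aestronglyMeasurable
    fun_prop
  · intro l
    refine Filter.Eventually.of_forall fun θ hθ => ?_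
    rw [Set.uIoc_of_le zero_le_one] at hθ
    have h1 : θ ^ p / (p ! : ℝ) ≤ 1 := by
      rw [div_le_one (by positivity)]
      exact (pow_le_one₀ hθ.1.le hθ.2).trans (by exact_mod_cast p.factorial_pos)
    have h2 : (1 - θ) ^ l ≤ 1 := pow_le_one₀ (by linarith [hθ.2]) (by linarith [hθ.1])
    have h3 : 0 ≤ (1 - θ) ^ l := pow_nonneg (by linarith [hθ.2]) _
    have h4 : 0 ≤ θ ^ p := pow_nonneg hθ.1.le _
    have h5 : ‖(A ^ l).mulVec b i‖ ≤ matrixNormInf A ^ l * ‖b‖ :=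
      (norm_le_pi_norm _ i).trans (norm_pow_mulVec_le A b l)
    rw [norm_smul, norm_smul, Real.norm_of_nonneg (by positivity),
      Real.norm_of_nonneg (by positivity)]
    calc θ ^ p / (p ! : ℝ) * ((1 - θ) ^ l / (l ! : ℝ) * ‖(A ^ l).mulVec b i‖)
        ≤ 1 * (1 / (l ! : ℝ) * (matrixNormInf A ^ l * ‖b‖)) := by gcongr
      _ = _ := by ring
  · exact Filter.Eventually.of_forall fun θ _ => summable_pow_mul_pow_div_factorial _ _
  · exact intervalIntegrable_const
  · exact Filter.Eventually.of_forall fun θ _ =>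
      (hasSum_exp_smul_mulVec A b (1 - θ) i).const_smul _

lemma hasSum_phiQuad (S : Finset ℝ) (p : ℕ) (A : Matrix ι ι 𝕜) (b : ι → 𝕜) (i : ι) :
    HasSum (fun l : ℕ => (quad S (X ^ p * (1 - X) ^ l) / (p ! * l ! : ℝ)) •
      (A ^ l).mulVec b i) (phiQuad S (p + 1) A b i) := by
  have h := hasSum_sum (s := S) fun x _ =>
    (hasSum_exp_smul_mulVec A b (1 - x) i).const_smul (weight S x * (x ^ p / (p ! : ℝ)))
  convert! h using 1
  · funext l
    simp only [smul_smul, ← Finset.sum_smul]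
    congr 1
    rw [quad_apply, Finset.sum_div]
    refine Finset.sum_congr rfl fun x _ => ?_
    simp
    field_simp
  · simp [phiQuad, Finset.sum_apply]

/-- The two series are subtracted termwise; the monomial bounds then sum to an exponential series.
-/
lemma quadError_le_of_defect {S : Finset ℝ} {ρ K : ℝ} (hρ : 1 + √2 ≤ ρ) (hK : 0 ≤ K)
    (h : ∀ k : ℕ, |defect S (shiftedT k)| ≤ K * ρ ^ k / 2) (p : ℕ) (A : Matrix ι ι 𝕜)
    (b : ι → 𝕜) :
    quadError S (p + 1) A b ≤
      ‖b‖ / (p ! : ℝ) * (K * (ρ / 2) ^ p * Real.exp (ρ / 2 * matrixNormInf A)) := by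
  have h0 : 0 < ρ := lt_of_lt_of_le (by positivity) hρ
  have ha := matrixNormInf_nonneg A
  rw [quadError, pi_norm_le_iff_of_nonneg (by positivity)]
  intro i
  have hs := (hasSum_phi_succ_mulVec p A b i).sub (hasSum_phiQuad S p A b i)
  have hexp : HasSum (fun l : ℕ => ‖b‖ / (p ! : ℝ) * (K * (ρ / 2) ^ p *
      ((ρ / 2 * matrixNormInf A) ^ l / (l ! : ℝ))))
      (‖b‖ / (p ! : ℝ) * (K * (ρ / 2) ^ p * Real.exp (ρ / 2 * matrixNormInf A))) := by
    have h1 := NormedSpace.expSeries_div_hasSum_exp (ρ / 2 * matrixNormInf A)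
    rw [← Real.exp_eq_exp_ℝ] at h1
    exact (h1.mul_left (K * (ρ / 2) ^ p)).mul_left (‖b‖ / (p ! : ℝ))
  rw [Pi.sub_apply, ← hs.tsum_eq]
  refine tsum_of_norm_bounded hexp fun l => ?_
  rw [← sub_smul, ← sub_div, ← defect_apply, norm_smul, Real.norm_eq_abs, abs_div,
    abs_of_pos (by positivity : (0 : ℝ) < p ! * l !)]
  have h5 : ‖(A ^ l).mulVec b i‖ ≤ matrixNormInf A ^ l * ‖b‖ :=
    (norm_le_pi_norm _ i).trans (norm_pow_mulVec_le A b l)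
  calc |defect S (X ^ p * (1 - X) ^ l)| / (p ! * l ! : ℝ) * ‖(A ^ l).mulVec b i‖
      ≤ (K * (ρ / 2) ^ (p + l)) / (p ! * l ! : ℝ) * (matrixNormInf A ^ l * ‖b‖) := by
        gcongr
        exact abs_defect_monomial_le hρ hK h p l
    _ = _ := by
        rw [pow_add, mul_pow]
        field_simp

/-! ### Choice of the ellipse -/

/-- The value `ρ = 2 N / a` minimizes `ρ ^ (-N) exp (ρ a / 2)`, and the exponential becomes `e ^ N`.
-/
lemma bound_optimal_ellipse {a : ℝ} (ha : 0 < a) (B : ℝ) (p N : ℕ) (hN : 0 < N) :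
    B / (p ! : ℝ) * ((1 / 2 * ((2 * N / a : ℝ) ^ (p + N))⁻¹) * ((2 * N / a : ℝ) / 2) ^ p *
      Real.exp ((2 * N / a : ℝ) / 2 * a)) =
    B / (2 ^ (p + 1) * (p ! : ℝ)) * ((N : ℝ) / (Real.exp 1 / 2 * a)) ^ (-(N : ℤ)) := by
  have hN' : (0 : ℝ) < N := by exact_mod_cast hN
  have he : Real.exp ((2 * N / a : ℝ) / 2 * a) = Real.exp 1 ^ N := by
    rw [← Real.exp_nat_mul]
    congr 1
    field_simp
  have hE := Real.exp_pos 1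
  rw [he, zpow_neg, zpow_natCast, pow_add, pow_succ, show (N : ℝ) / (Real.exp 1 / 2 * a) =
    (2 * N / a) / Real.exp 1 by field_simp]
  have hr : (0 : ℝ) < 2 * N / a := by positivity
  generalize (2 * N / a : ℝ) = ρ at hr ⊢
  rw [div_pow, div_pow]
  field_simp

/-- For odd `n` put `N = n - 1 - p`. The optimal `2 N / a` may fall below `1 + √2`, whereas `2 (N +
1) / a` does not under the hypothesis on `n`. The exponential then has one surplus factor `e`,
cancelled by `e⁻¹`. -/
lemma bound_shifted_ellipse {a : ℝ} (ha : 0 < a) {B : ℝ} (hB : 0 ≤ B) (p N : ℕ) :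
    B / (p ! : ℝ) * ((1 / 2 * ((Real.exp 1)⁻¹ * ((2 * (N + 1) / a : ℝ) ^ (p + N))⁻¹)) *
      ((2 * (N + 1) / a : ℝ) / 2) ^ p * Real.exp ((2 * (N + 1) / a : ℝ) / 2 * a)) ≤
    B / (2 ^ (p + 1) * (p ! : ℝ)) * ((N : ℝ) / (Real.exp 1 / 2 * a)) ^ (-(N : ℤ)) := by
  have he : Real.exp ((2 * (N + 1) / a : ℝ) / 2 * a) = Real.exp 1 ^ N * Real.exp 1 := by
    rw [← pow_succ, ← Real.exp_nat_mul]
    congr 1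
    push_cast
    field_simp
  have hE := Real.exp_pos 1
  rw [he, zpow_neg, zpow_natCast, pow_add, pow_succ]
  have hr : (0 : ℝ) < 2 * (N + 1) / a := by positivity
  have hle : (N : ℝ) / (Real.exp 1 / 2 * a) ≤ (2 * (N + 1) / a) / Real.exp 1 := by
    rw [show (2 * (N + 1) / a : ℝ) / Real.exp 1 = (N + 1) / (Real.exp 1 / 2 * a) by field_simp]
    gcongr
    linarith
  -- For `N = 0` the base is zero and positivity rests on `0 ^ 0 = 1`.
  have hpos : 0 < ((N : ℝ) / (Real.exp 1 / 2 * a)) ^ N := by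
    rcases N.eq_zero_or_pos with rfl | hN
    · simp
    · positivity
  refine le_trans (le_of_eq ?_) (mul_le_mul_of_nonneg_left
    (inv_anti₀ hpos (pow_le_pow_left₀ (by positivity) hle N)) (by positivity))
  generalize (2 * (N + 1) / a : ℝ) = ρ at hr ⊢
  rw [div_pow, div_pow]
  field_simp

/-! ### Supergeometric convergence -/

lemma supergeometric_of_le {e : ℕ → ℝ}
    (h : ∀ ρ : ℝ, 1 + √2 ≤ ρ → ∃ C : ℝ, ∀ n : ℕ, 5 ≤ n → |e n| ≤ C * (ρ ^ n)⁻¹) :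
    Supergeometric e := by
  intro r hr
  -- The choice forces `ρ⁻¹ ≤ r / 2`, strictly below `r`.
  obtain ⟨C, hC⟩ := h (max (1 + √2) (2 / r)) (le_max_left _ _)
  have hρ : 2 / r ≤ max (1 + √2) (2 / r) := le_max_right _ _
  generalize max (1 + √2) (2 / r) = ρ at hC hρ
  have h0 : 0 < 2 / r := by positivity
  have hle : ρ⁻¹ ≤ r / 2 := by
    rw [← inv_div 2 r]
    exact inv_anti₀ h0 hρ
  have hρ0 : 0 < ρ := h0.trans_le hρ
  refine IsBigO.trans_isLittleO (g := fun n : ℕ => (ρ⁻¹) ^ n) ?_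
    (isLittleO_pow_pow_of_lt_left (by positivity) (by linarith))
  refine IsBigO.of_bound C ?_
  filter_upwards [Filter.eventually_ge_atTop 5] with n hn
  rw [Real.norm_eq_abs, Real.norm_of_nonneg (by positivity), inv_pow]
  exact hC n hn

lemma abs_quadError (S : Finset ℝ) (j : ℕ) (A : Matrix ι ι 𝕜) (b : ι → 𝕜) :
    |quadError S j A b| = quadError S j A b := abs_of_nonneg (norm_nonneg _)

lemma supergeometric_clenshawCurtis (A : Matrix ι ι 𝕜) (b : ι → 𝕜) (p : ℕ) :
    Supergeometric fun n => quadError (clenshawCurtisNodes n) (p + 1) A b := by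
  refine supergeometric_of_le fun ρ hρ => ?_
  have h1 : 1 ≤ ρ := le_trans (by linarith [Real.sqrt_nonneg 2]) hρ
  have hE := Real.exp_pos 1
  set D := (ρ / 2) ^ p * Real.exp (ρ / 2 * matrixNormInf A) with hD
  have hD0 : 0 < D := by positivity
  -- The additional `ρ` in the constant absorbs the exponent `n - 1` of the odd case.
  refine ⟨‖b‖ / (p ! : ℝ) * ((1 / 2 * ρ) * D), fun n hn => ?_⟩
  rw [abs_quadError]
  rcases n.even_or_odd with he | ho
  · refine (quadError_le_of_defect hρ (by positivity)
      (abs_defect_clenshawCurtis_even (by omega) he hρ) p A b).trans ?_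
    calc ‖b‖ / (p ! : ℝ) * (1 / 2 * (ρ ^ n)⁻¹ * (ρ / 2) ^ p * Real.exp (ρ / 2 * matrixNormInf A))
        = ‖b‖ / (p ! : ℝ) * ((1 / 2 * 1) * D) * (ρ ^ n)⁻¹ := by rw [hD]; ring
      _ ≤ _ := by gcongr
  · refine (quadError_le_of_defect hρ (by positivity)
      (abs_defect_clenshawCurtis_of_odd hn ho hρ) p A b).trans ?_
    have hinv : (ρ ^ (n - 1))⁻¹ = ρ * (ρ ^ n)⁻¹ := by
      obtain ⟨m, rfl⟩ := Nat.exists_eq_add_of_lt hn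
      rw [Nat.add_sub_cancel, pow_succ]
      field_simp
    have he1 : (Real.exp 1)⁻¹ ≤ 1 := inv_le_one_of_one_le₀ (Real.one_le_exp zero_le_one)
    calc ‖b‖ / (p ! : ℝ) * (1 / 2 * ((Real.exp 1)⁻¹ * (ρ ^ (n - 1))⁻¹) * (ρ / 2) ^ p *
          Real.exp (ρ / 2 * matrixNormInf A))
        = (Real.exp 1)⁻¹ * (‖b‖ / (p ! : ℝ) * ((1 / 2 * ρ) * D) * (ρ ^ n)⁻¹) := by
          rw [hD, hinv]; ring
      _ ≤ _ := mul_le_of_le_one_left (by positivity) he1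

lemma supergeometric_gauss (A : Matrix ι ι 𝕜) (b : ι → 𝕜) (p : ℕ) :
    Supergeometric fun n => quadError (gaussNodes n) (p + 1) A b := by
  refine supergeometric_of_le fun ρ hρ => ?_
  have h1 : 1 ≤ ρ := le_trans (by linarith [Real.sqrt_nonneg 2]) hρ
  refine ⟨‖b‖ / (p ! : ℝ) * (1 / 2 * (ρ / 2) ^ p * Real.exp (ρ / 2 * matrixNormInf A)),
    fun n hn => ?_⟩
  rw [abs_quadError]
  refine (quadError_le_of_defect hρ (by positivity) (abs_defect_gauss (by omega) hρ) p A b).trans ?_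
  have hle : (ρ ^ (2 * n))⁻¹ ≤ (ρ ^ n)⁻¹ :=
    inv_anti₀ (by positivity) (pow_le_pow_right₀ h1 (by omega))
  calc ‖b‖ / (p ! : ℝ) * (1 / 2 * (ρ ^ (2 * n))⁻¹ * (ρ / 2) ^ p *
        Real.exp (ρ / 2 * matrixNormInf A))
      ≤ ‖b‖ / (p ! : ℝ) * (1 / 2 * (ρ ^ n)⁻¹ * (ρ / 2) ^ p *
        Real.exp (ρ / 2 * matrixNormInf A)) := by gcongr
    _ = _ := by ring

end PhiQuadrature

end

/-! ### The explicit error bounds for both rules -/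

theorem corollary3p3 {𝕜 ι : Type*} [RCLike 𝕜] [Fintype ι] [DecidableEq ι]
    (A : Matrix ι ι 𝕜) (hA : A ≠ 0) (b : ι → 𝕜) (p : ℕ) :
    (∀ n : ℕ, max 4 ⌈(1 + √2) / 2 * PhiQuadrature.matrixNormInf A + p⌉₊ ≤ n → Even n →
      PhiQuadrature.quadError (PhiQuadrature.clenshawCurtisNodes n) (p + 1) A b ≤
        ‖b‖ / (2 ^ (p + 1) * (p ! : ℝ)) *
          (((n : ℝ) - p) / (Real.exp 1 / 2 * PhiQuadrature.matrixNormInf A)) ^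
            (-((n : ℤ) - p))) ∧
    (∀ n : ℕ, max 4 ⌈(1 + √2) / 2 * PhiQuadrature.matrixNormInf A + p⌉₊ ≤ n → Odd n →
      PhiQuadrature.quadError (PhiQuadrature.clenshawCurtisNodes n) (p + 1) A b ≤
        ‖b‖ / (2 ^ (p + 1) * (p ! : ℝ)) *
          (((n : ℝ) - 1 - p) / (Real.exp 1 / 2 * PhiQuadrature.matrixNormInf A)) ^
            (-((n : ℤ) - 1 - p))) ∧
    (∀ n : ℕ, max 2 ⌈(1 + √2) / 4 * PhiQuadrature.matrixNormInf A + (p : ℝ) / 2⌉₊ ≤ n →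
      PhiQuadrature.quadError (PhiQuadrature.gaussNodes n) (p + 1) A b ≤
        ‖b‖ / (2 ^ (p + 1) * (p ! : ℝ)) *
          ((2 * (n : ℝ) - p) / (Real.exp 1 / 2 * PhiQuadrature.matrixNormInf A)) ^
            (-(2 * (n : ℤ) - p))) ∧
    PhiQuadrature.Supergeometric
      (fun n => PhiQuadrature.quadError (PhiQuadrature.clenshawCurtisNodes n) (p + 1) A b) ∧
    PhiQuadrature.Supergeometric
      (fun n => PhiQuadrature.quadError (PhiQuadrature.gaussNodes n) (p + 1) A b) := by
  have ha : 0 < PhiQuadrature.matrixNormInf A := PhiQuadrature.matrixNormInf_pos hA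
  have hs : 0 < 1 + √2 := by positivity
  refine ⟨fun n hn he => ?_, fun n hn ho => ?_, fun n hn => ?_,
    PhiQuadrature.supergeometric_clenshawCurtis A b p, PhiQuadrature.supergeometric_gauss A b p⟩
  · rw [max_le_iff, Nat.ceil_le] at hn
    obtain ⟨hn4, hn⟩ := hn
    have hpn : p < n := by
      have : (p : ℝ) < n := by nlinarith
      exact_mod_cast this
    obtain ⟨N, rfl⟩ := Nat.exists_eq_add_of_lt hpn
    rw [add_assoc] at *
    have hρ : 1 + √2 ≤ 2 * (N + 1 : ℕ) / PhiQuadrature.matrixNormInf A := by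
      rw [le_div_iff₀ ha]
      push_cast at hn ⊢
      linarith
    refine (PhiQuadrature.quadError_le_of_defect hρ (by positivity)
      (PhiQuadrature.abs_defect_clenshawCurtis_even hn4 he hρ) p A b).trans (le_of_eq ?_)
    rw [PhiQuadrature.bound_optimal_ellipse ha _ p (N + 1) N.succ_pos]
    congr 2
    · push_cast; ring
    · push_cast; ring
  · rw [max_le_iff, Nat.ceil_le] at hn
    obtain ⟨hn4, hn⟩ := hn
    have hpn : p < n := by
      have : (p : ℝ) < n := by nlinarith
      exact_mod_cast this
    obtain ⟨N, rfl⟩ := Nat.exists_eq_add_of_lt hpn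
    -- Here `N + 1 = n - p`, so the ellipse is the one of the even case although the target exponent
    -- is `N`.
    have hρ : 1 + √2 ≤ 2 * (N + 1) / PhiQuadrature.matrixNormInf A := by
      rw [le_div_iff₀ ha]
      push_cast at hn
      linarith
    -- An odd number that is at least 4 is at least 5.
    have h5 : 5 ≤ p + N + 1 := by
      rcases ho with ⟨c, hc⟩; omega
    refine (PhiQuadrature.quadError_le_of_defect hρ (by positivity)
      (PhiQuadrature.abs_defect_clenshawCurtis_of_odd h5 ho hρ) p A b).trans ?_
    rw [Nat.add_sub_cancel]
    refine (PhiQuadrature.bound_shifted_ellipse ha (norm_nonneg b) p N).trans (le_of_eq ?_)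
    congr 2
    · push_cast; ring
    · push_cast; ring
  · rw [max_le_iff, Nat.ceil_le] at hn
    obtain ⟨hn2, hn⟩ := hn
    have hpn : p < 2 * n := by
      have : (p : ℝ) < 2 * n := by nlinarith
      exact_mod_cast this
    obtain ⟨N, hN⟩ := Nat.exists_eq_add_of_lt hpn
    rw [add_assoc] at hN
    have hNr : 2 * (n : ℝ) = p + (N + 1) := by exact_mod_cast hN
    have hNz : 2 * (n : ℤ) = p + (N + 1) := by exact_mod_cast hN
    have hρ : 1 + √2 ≤ 2 * (N + 1 : ℕ) / PhiQuadrature.matrixNormInf A := by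
      rw [le_div_iff₀ ha]
      push_cast
      linarith
    refine (PhiQuadrature.quadError_le_of_defect hρ (by positivity)
      (PhiQuadrature.abs_defect_gauss hn2 hρ) p A b).trans (le_of_eq ?_)
    rw [hN, PhiQuadrature.bound_optimal_ellipse ha _ p (N + 1) N.succ_pos, hNr, hNz]
    congr 2
    · push_cast; ring
    · push_cast; ring
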